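/- Let $L\ge 0$ be an integer and let $\mathcal L=\{1,\dots,L\}$ be a set of lattice sites, each carrying one bosonic mode with annihilation and creation operators $\hat b_i,\hat b_i^\dagger$, acting on the Fock space $\mathcal H$ with number basis $|n_1,\dots,n_L\rangle$. Let $\hat\varrho_0$ be a density operator on $\mathcal H$ (positive, of trace one) that commutes with the total particle number operator, $[\hat\varrho_0,\sum_{i\in\mathcal L}\hat b_i^\dagger\hat b_i]=0$, and write $\langle\hat O\rangle=\mathrm{tr}[\hat\varrho_0\hat O]$ (for unbounded $\hat O$ understood as the trace of $\hat\varrho_0^{1/2}\hat O\,\hat\varrho_0^{1/2}$). For $\vec\alpha\in\mathbb C^L$ let $$\hat b(\vec\alpha)=\sum_{i\in\mathcal L}\bigl(\alpha_i\hat b_i^\dagger-\alpha_i^*\hat b_i\bigr),\qquad \hat D(\vec\alpha)=\mathrm e^{\hat b(\vec\alpha)}$$ (so $\hat D(\vec\alpha)$ is the Weyl operator). For $\mathcal A\subset\mathcal L$ let $\vec\alpha_{\mathcal A}$ be the vector with entries $\alpha_i$ for $i\in\mathcal A$ and $0$ otherwise, and put $$\sigma_{\mathcal A}=\langle\hat b(\vec\alpha_{\mathcal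 A})^2\rangle,\qquad f_{\mathcal A}=\langle\hat b(\vec\alpha_{\mathcal A})^4\rangle .$$ **Theorem (Lindeberg quantum central limit theorem).** Let $\vec\alpha\in\mathbb C^L$ and let $\mathcal A_1,\dots,\mathcal A_n\subset\mathcal L$ be mutually disjoint sets such that $f_{\mathcal A_i}<\infty$ and $|\sigma_{\mathcal A_i}|\le 1$ for all $i$. Then $$\left|\prod_{i=1}^n\langle\hat D(\vec\alpha_{\mathcal A_i})\rangle-\mathrm e^{\sum_{i=1}^n\sigma_{\mathcal A_i}/2}\right|\le\frac{7}{24}\sum_{i=1}^n|f_{\mathcal A_i}|.$$ -/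

import Mathlib

namespace BosonChain

open scoped ComplexConjugate Nat

/-! ### Fock space of finitely many bosonic modes -/

/-- Occupation numbers of the `L` lattice sites. -/
abbrev Occ (L : ℕ) : Type := Fin L → ℕ

/-- Coefficient families with respect to the number basis, without any summability condition. -/
abbrev Coeff (L : ℕ) : Type := Occ L → ℂ

/-- The Hilbert space of `L` bosonic modes: square-summable families of coefficients with respect
to the number basis `|n₁, …, n_L⟩`. -/
abbrev Fock (L : ℕ) : Type := lp (fun _ : Occ L => ℂ) 2

/-- The coefficients of a vector with respect to the number basis. -/
noncomputable def coeffs {L : ℕ} : Fock L →ₗ[ℂ] Coeff L where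
  toFun ψ n := ψ n
  map_add' _ _ := rfl
  map_smul' _ _ := rfl

/-- The number basis vector `|n₁, …, n_L⟩`. -/
noncomputable def numberVec {L : ℕ} (n : Occ L) : Fock L := lp.single 2 n (1 : ℂ)

/-- The creation operator `b_i†`, `b_i† |n⟩ = √(n_i + 1) |n + e_i⟩`, acting on coefficients.

The unbounded operators below are given by their action on coefficient families; as operators on
the Hilbert space they have the maximal domain of all `ψ` in `Fock L` that are mapped into
`Fock L`. -/
noncomputable def create {L : ℕ} (i : Fin L) : Module.End ℂ (Coeff L) where
  toFun ψ n := (Real.sqrt (n i) : ℂ) * ψ (Function.update n i (n i - 1))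
  map_add' ψ χ := by ext n; simp [mul_add]
  map_smul' c ψ := by ext n; simp; ring

/-- The annihilation operator `b_i`, `b_i |n⟩ = √(n_i) |n - e_i⟩`, acting on coefficients. -/
noncomputable def annihilate {L : ℕ} (i : Fin L) : Module.End ℂ (Coeff L) where
  toFun ψ n := (Real.sqrt (n i + 1) : ℂ) * ψ (Function.update n i (n i + 1))
  map_add' ψ χ := by ext n; simp [mul_add]
  map_smul' c ψ := by ext n; simp; ring

/-- The total particle number operator `∑ i, b_i† b_i`. -/
noncomputable def totalNumber (L : ℕ) : Module.End ℂ (Coeff L) :=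
  ∑ i : Fin L, create i * annihilate i

/-- The anti-hermitian operator `b(α) = ∑ i, (α_i b_i† - α_i^* b_i)`. -/
noncomputable def field {L : ℕ} (α : Fin L → ℂ) : Module.End ℂ (Coeff L) :=
  ∑ i : Fin L, (α i • create i - conj (α i) • annihilate i)

/-! ### The Weyl operator `D(α) = exp b(α)` -/

/-- The bounded operator `U` is the exponential of the operator `X`: its matrix elements in the
number basis are given by the exponential series, `⟨m|U|n⟩ = ∑ k, ⟨m|X ^ k|n⟩ / k!`. -/
def IsExpOf {L : ℕ} (X : Module.End ℂ (Coeff L)) (U : Fock L →L[ℂ] Fock L) : Prop :=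
  ∀ n m : Occ L, HasSum (fun k : ℕ => ((k ! : ℂ)⁻¹) * (X ^ k) (coeffs (numberVec n)) m)
    (coeffs (U (numberVec n)) m)

lemma numberVec_apply {L : ℕ} (n m : Occ L) :
    (coeffs (numberVec n)) m = if m = n then 1 else 0 := by
  change (lp.single 2 n (1 : ℂ) : Fock L) m = _
  rw [lp.single_apply, Pi.single_apply]

lemma create_numberVec {L : ℕ} (i : Fin L) (n : Occ L) :
    create i (coeffs (numberVec n)) = (Real.sqrt (n i + 1) : ℂ) •
      coeffs (numberVec (Function.update n i (n i + 1))) := by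
  ext m
  simp only [create, LinearMap.coe_mk, AddHom.coe_mk, Pi.smul_apply, smul_eq_mul, numberVec_apply]
  by_cases h : m = Function.update n i (n i + 1)
  · subst h; simp
  · rw [if_neg h, mul_zero]
    rcases Nat.eq_zero_or_pos (m i) with h0 | h0
    · simp [h0]
    · rw [if_neg, mul_zero]
      rintro rfl
      apply h
      simp [Nat.sub_add_cancel h0]

lemma annihilate_numberVec {L : ℕ} (i : Fin L) (n : Occ L) :
    annihilate i (coeffs (numberVec n)) = (Real.sqrt (n i) : ℂ) •
      coeffs (numberVec (Function.update n i (n i - 1))) := by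
  ext m
  simp only [annihilate, LinearMap.coe_mk, AddHom.coe_mk, Pi.smul_apply, smul_eq_mul,
    numberVec_apply]
  by_cases h : Function.update m i (m i + 1) = n
  · subst h; simp
  · rw [if_neg h, mul_zero]
    rcases Nat.eq_zero_or_pos (n i) with h0 | h0
    · simp [h0]
    · rw [if_neg, mul_zero]
      rintro rfl
      apply h
      simp [Nat.sub_add_cancel h0]

/-- The vector `b(α) |n⟩`. -/
noncomputable def fieldVec {L : ℕ} (α : Fin L → ℂ) (n : Occ L) : Occ L →₀ ℂ :=
  ∑ i : Fin L, (Finsupp.single (Function.update n i (n i + 1)) (α i * Real.sqrt (n i + 1))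
    - Finsupp.single (Function.update n i (n i - 1)) (conj (α i) * Real.sqrt (n i)))

/-- The embedding of finite linear combinations of number basis vectors. -/
noncomputable def toFock (L : ℕ) : (Occ L →₀ ℂ) →ₗ[ℂ] Fock L :=
  Finsupp.linearCombination ℂ numberVec

/-- `b(α)` on finite linear combinations of number basis vectors. -/
noncomputable def fieldFin {L : ℕ} (α : Fin L → ℂ) : Module.End ℂ (Occ L →₀ ℂ) :=
  Finsupp.linearCombination ℂ (fieldVec α)

lemma field_toFock {L : ℕ} (α : Fin L → ℂ) (v : Occ L →₀ ℂ) :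
    field α (coeffs (toFock L v)) = coeffs (toFock L (fieldFin α v)) := by
  induction v using Finsupp.induction_linear with
  | zero => simp
  | add v w hv hw => simp only [map_add, hv, hw]
  | single n c =>
    simp only [toFock, fieldFin, Finsupp.linearCombination_single, map_smul, field, fieldVec,
      map_sum, LinearMap.sum_apply, map_sub, LinearMap.sub_apply, LinearMap.smul_apply,
      create_numberVec, annihilate_numberVec, smul_smul]

lemma field_pow_toFock {L : ℕ} (α : Fin L → ℂ) (k : ℕ) (v : Occ L →₀ ℂ) :
    (field α ^ k) (coeffs (toFock L v)) = coeffs (toFock L ((fieldFin α ^ k) v)) := by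
  induction k with
  | zero => simp
  | succ k ih => rw [pow_succ', pow_succ', Module.End.mul_apply, ih, field_toFock]; rfl

lemma field_skew_aux {L : ℕ} (α : Fin L → ℂ) (n m : Occ L) :
    inner ℂ (toFock L (fieldVec α n)) (numberVec m)
      = -inner ℂ (numberVec n) (toFock L (fieldVec α m)) := by
  have hin : ∀ n m : Occ L, inner ℂ (numberVec n) (numberVec m) = if n = m then (1 : ℂ) else 0 := by
    intro n m
    rw [numberVec, lp.inner_single_left]
    change inner ℂ (1 : ℂ) (coeffs (numberVec m) n) = _
    rw [numberVec_apply]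
    split_ifs <;> simp
  have key : ∀ (i : Fin L) (n m : Occ L),
      (if Function.update n i (n i + 1) = m then (Real.sqrt (n i + 1) : ℂ) else 0)
        = if n = Function.update m i (m i - 1) then (Real.sqrt (m i) : ℂ) else 0 := by
    intro i n m
    by_cases h : Function.update n i (n i + 1) = m
    · subst h; simp
    · rw [if_neg h]
      rcases Nat.eq_zero_or_pos (m i) with h0 | h0
      · simp [h0]
      · rw [if_neg]
        rintro rfl
        apply h
        simp [Nat.sub_add_cancel h0]
  simp only [fieldVec, map_sum, map_sub, sum_inner, inner_sum, inner_sub_left, inner_sub_right,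
    toFock, Finsupp.linearCombination_single, inner_smul_left, inner_smul_right, hin]
  rw [← Finset.sum_neg_distrib]
  refine Finset.sum_congr rfl fun i _ => ?_
  have k1 := key i n m
  have k2 := key i m n
  simp only [map_mul, Complex.conj_conj, Complex.conj_ofReal, mul_ite, mul_one, mul_zero]
  simp only [eq_comm (a := m)] at k2
  simp only [@eq_comm _ (Function.update m i (m i + 1)) n] at k2
  have e1 : (if Function.update n i (n i + 1) = m then conj (α i) * (Real.sqrt (n i + 1) : ℂ) else 0)
      = if n = Function.update m i (m i - 1) then conj (α i) * (Real.sqrt (m i) : ℂ) else 0 := by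
    rw [← mul_ite_zero, ← mul_ite_zero, k1]
  have e2 : (if n = Function.update m i (m i + 1) then α i * (Real.sqrt (m i + 1) : ℂ) else 0)
      = if Function.update n i (n i - 1) = m then α i * (Real.sqrt (n i) : ℂ) else 0 := by
    rw [← mul_ite_zero, ← mul_ite_zero, k2]
  rw [e1, e2]; ring

lemma fieldFin_skew {L : ℕ} (α : Fin L → ℂ) (v w : Occ L →₀ ℂ) :
    inner ℂ (toFock L (fieldFin α v)) (toFock L w)
      = -inner ℂ (toFock L v) (toFock L (fieldFin α w)) := by
  induction v using Finsupp.induction_linear with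
  | zero => simp
  | add v v' hv hv' => simp only [map_add, inner_add_left, hv, hv']; ring
  | single n c =>
    induction w using Finsupp.induction_linear with
    | zero => simp
    | add w w' hw hw' => simp only [map_add, inner_add_right, hw, hw']; ring
    | single m d =>
      have h := field_skew_aux α n m
      simp only [fieldFin, Finsupp.linearCombination_single, map_smul, inner_smul_left,
        inner_smul_right, toFock] at h ⊢
      rw [h]; ring

lemma fieldFin_pow_skew {L : ℕ} (α : Fin L → ℂ) (j k : ℕ) (v w : Occ L →₀ ℂ) :
    inner ℂ (toFock L ((fieldFin α ^ j) v)) (toFock L ((fieldFin α ^ k) w))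
      = (-1) ^ j * inner ℂ (toFock L v) (toFock L ((fieldFin α ^ (j + k)) w)) := by
  induction j generalizing k with
  | zero => simp
  | succ j ih =>
    have h1 : (fieldFin α ^ (j + 1)) v = fieldFin α ((fieldFin α ^ j) v) := by
      rw [pow_succ']; rfl
    have h2 : fieldFin α ((fieldFin α ^ k) w) = (fieldFin α ^ (k + 1)) w := by
      rw [pow_succ']; rfl
    rw [h1, fieldFin_skew, h2, ih, show j + (k + 1) = j + 1 + k by ring, pow_succ]
    ring

lemma norm_numberVec {L : ℕ} (n : Occ L) : ‖(numberVec n : Fock L)‖ = 1 := by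
  simp [numberVec, lp.norm_single]

lemma fieldFin_pow_bound {L : ℕ} (α : Fin L → ℂ) (k N : ℕ) (n : Occ L) (hn : ∑ i, n i ≤ N) :
    ‖toFock L ((fieldFin α ^ k) (Finsupp.single n 1))‖
      ≤ (2 * ∑ i, ‖α i‖) ^ k * ∏ j ∈ Finset.range k, Real.sqrt (N + 1 + j) := by
  induction k generalizing n N with
  | zero => simp [toFock, norm_numberVec]
  | succ k ih =>
    have h1 : (fieldFin α ^ (k + 1)) (Finsupp.single n 1) = (fieldFin α ^ k) (fieldVec α n) := by
      rw [pow_succ, Module.End.mul_apply, fieldFin, Finsupp.linearCombination_single, one_smul]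
    set M : ℝ := (2 * ∑ i, ‖α i‖) ^ k * ∏ j ∈ Finset.range k, Real.sqrt (((N + 1 : ℕ) : ℝ) + 1 + j)
      with hM
    have hM0 : 0 ≤ M := by positivity
    have hs : ∀ (c : ℂ) (m : Occ L), ∑ i, m i ≤ N + 1 →
        ‖toFock L ((fieldFin α ^ k) (Finsupp.single m c))‖ ≤ ‖c‖ * M := by
      intro c m hm
      have : Finsupp.single m c = c • Finsupp.single m (1 : ℂ) := by simp
      rw [this, map_smul, map_smul, norm_smul]
      exact mul_le_mul_of_nonneg_left (ih (N + 1) m hm) (norm_nonneg c)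
    have hle : ∀ i, n i ≤ N := fun i =>
      (Finset.single_le_sum (f := n) (fun _ _ => Nat.zero_le _) (Finset.mem_univ i)).trans hn
    have hup : ∀ i, ∑ l, Function.update n i (n i + 1) l ≤ N + 1 := by
      intro i
      rw [Finset.sum_update_of_mem (Finset.mem_univ i)]
      have := Finset.add_sum_erase Finset.univ n (Finset.mem_univ i)
      rw [Finset.sdiff_singleton_eq_erase]; omega
    have hdn : ∀ i, ∑ l, Function.update n i (n i - 1) l ≤ N + 1 := by
      intro i
      rw [Finset.sum_update_of_mem (Finset.mem_univ i)]
      have := Finset.add_sum_erase Finset.univ n (Finset.mem_univ i)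
      rw [Finset.sdiff_singleton_eq_erase]; omega
    rw [h1, fieldVec, map_sum, map_sum]
    calc _ ≤ ∑ i, 2 * ‖α i‖ * (Real.sqrt (N + 1) * M) := by
          refine norm_sum_le_of_le _ fun i _ => ?_
          rw [map_sub, map_sub]
          refine (norm_sub_le _ _).trans ?_
          have a1 := hs (α i * Real.sqrt (n i + 1)) _ (hup i)
          have a2 := hs (conj (α i) * Real.sqrt (n i)) _ (hdn i)
          have hi : (n i : ℝ) ≤ N := by exact_mod_cast hle i
          rw [norm_mul, Complex.norm_real, Real.norm_of_nonneg (Real.sqrt_nonneg _)] at a1 a2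
          rw [RCLike.norm_conj] at a2
          have b1 : Real.sqrt ((n i : ℝ) + 1) ≤ Real.sqrt (N + 1) := Real.sqrt_le_sqrt (by linarith)
          have b2 : Real.sqrt (n i : ℝ) ≤ Real.sqrt (N + 1) := Real.sqrt_le_sqrt (by linarith)
          have c1 : ‖α i‖ * Real.sqrt ((n i : ℝ) + 1) * M ≤ ‖α i‖ * Real.sqrt (N + 1) * M := by
            gcongr
          have c2 : ‖α i‖ * Real.sqrt (n i : ℝ) * M ≤ ‖α i‖ * Real.sqrt (N + 1) * M := by
            gcongr
          linarith
      _ = _ := by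
          rw [← Finset.sum_mul, ← Finset.mul_sum, Finset.prod_range_succ', hM, pow_succ]
          have : ∀ j ∈ Finset.range k, Real.sqrt (((N + 1 : ℕ) : ℝ) + 1 + j)
              = Real.sqrt ((N : ℝ) + 1 + ((j + 1 : ℕ) : ℝ)) := by
            intro j _; congr 1; push_cast; ring
          rw [Finset.prod_congr rfl this]
          simp only [Nat.cast_zero, add_zero]
          ring

lemma summable_exp_bound (C : ℝ) (N : ℕ) (hC : 0 ≤ C) :
    Summable (fun k : ℕ => ((k ! : ℝ)⁻¹) *
      (C ^ k * ∏ j ∈ Finset.range k, Real.sqrt (N + 1 + j))) := by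
  rcases hC.eq_or_lt with rfl | hC
  · refine summable_of_ne_finset_zero (s := {0}) fun k hk => ?_
    simp at hk
    simp [hk]
  have hpos : ∀ k : ℕ, 0 < ((k ! : ℝ)⁻¹) * (C ^ k * ∏ j ∈ Finset.range k, Real.sqrt (N + 1 + j)) := by
    intro k
    have : 0 < ∏ j ∈ Finset.range k, Real.sqrt ((N : ℝ) + 1 + j) :=
      Finset.prod_pos fun j _ => Real.sqrt_pos.2 (by positivity)
    positivity
  refine summable_of_ratio_test_tendsto_lt_one (l := 0) one_pos
    (Filter.Eventually.of_forall fun k => (hpos k).ne') ?_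
  have hr : ∀ k : ℕ, ‖(((k + 1) ! : ℝ)⁻¹) * (C ^ (k + 1) *
        ∏ j ∈ Finset.range (k + 1), Real.sqrt (N + 1 + j))‖ /
      ‖((k ! : ℝ)⁻¹) * (C ^ k * ∏ j ∈ Finset.range k, Real.sqrt (N + 1 + j))‖
      = C * (Real.sqrt (N + 1 + k) / (k + 1)) := by
    intro k
    rw [Real.norm_of_nonneg (hpos _).le, Real.norm_of_nonneg (hpos _).le, div_eq_iff (hpos k).ne',
      Finset.prod_range_succ, Nat.factorial_succ]
    push_cast
    field_simp
    ring
  simp only [hr]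
  rw [← mul_zero C]
  refine Filter.Tendsto.const_mul C ?_
  have hlim : Filter.Tendsto (fun k : ℕ => (N + 1 : ℝ) * (Real.sqrt ((k : ℝ) + 1))⁻¹)
      Filter.atTop (nhds 0) := by
    rw [← mul_zero ((N : ℝ) + 1)]
    refine Filter.Tendsto.const_mul _ (Filter.Tendsto.inv_tendsto_atTop ?_)
    exact Real.tendsto_sqrt_atTop.comp
      (Filter.tendsto_atTop_add_const_right _ _ tendsto_natCast_atTop_atTop)
  refine squeeze_zero (fun k => by positivity) (fun k => ?_) hlim
  have hk : (0 : ℝ) < (k : ℝ) + 1 := by positivity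
  rw [div_le_iff₀ hk]
  have h2 : Real.sqrt ((k : ℝ) + 1) * Real.sqrt ((k : ℝ) + 1) = (k : ℝ) + 1 :=
    Real.mul_self_sqrt hk.le
  have h3 : 0 < Real.sqrt ((k : ℝ) + 1) := Real.sqrt_pos.2 hk
  have h4 : (N + 1 : ℝ) * (Real.sqrt ((k : ℝ) + 1))⁻¹ * ((k : ℝ) + 1)
      = (N + 1) * Real.sqrt ((k : ℝ) + 1) := by
    rw [mul_assoc]; congr 1
    rw [inv_mul_eq_iff_eq_mul₀ h3.ne']; exact h2.symm
  rw [h4, Real.sqrt_le_left (by positivity), mul_pow, Real.sq_sqrt hk.le]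
  have hN : (0 : ℝ) ≤ N := Nat.cast_nonneg N
  have hk' : (0 : ℝ) ≤ k := Nat.cast_nonneg k
  nlinarith [mul_nonneg hN hk', mul_nonneg hN hN, mul_nonneg (mul_nonneg hN hN) hk']

lemma summable_exp_series {L : ℕ} (α : Fin L → ℂ) (v : Occ L →₀ ℂ) :
    Summable (fun k : ℕ => ‖((k ! : ℂ)⁻¹) • toFock L ((fieldFin α ^ k) v)‖) := by
  induction v using Finsupp.induction_linear with
  | zero => simp
  | add v w hv hw =>
    refine Summable.of_nonneg_of_le (fun _ => norm_nonneg _) (fun k => ?_) (hv.add hw)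
    rw [map_add, map_add, smul_add]
    exact norm_add_le _ _
  | single n c =>
    have h := (summable_exp_bound (2 * ∑ i, ‖α i‖) (∑ i, n i) (by positivity)).mul_left ‖c‖
    refine Summable.of_nonneg_of_le (fun _ => norm_nonneg _) (fun k => ?_) h
    have : Finsupp.single n c = c • Finsupp.single n (1 : ℂ) := by simp
    rw [this, map_smul, map_smul, norm_smul, norm_smul, norm_inv, Complex.norm_natCast,
      mul_left_comm]
    gcongr
    exact fieldFin_pow_bound α k _ n le_rfl

/-- The exponential series of `b(α)` on finite linear combinations of number basis vectors. -/
noncomputable def expFin {L : ℕ} (α : Fin L → ℂ) : (Occ L →₀ ℂ) →ₗ[ℂ] Fock L where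
  toFun v := ∑' k : ℕ, ((k ! : ℂ)⁻¹) • toFock L ((fieldFin α ^ k) v)
  map_add' v w := by
    simp only [map_add, smul_add]
    exact (summable_exp_series α v).of_norm.tsum_add (summable_exp_series α w).of_norm
  map_smul' c v := by
    simp only [map_smul, RingHom.id_apply]
    rw [← (summable_exp_series α v).of_norm.tsum_const_smul]
    exact tsum_congr fun k => smul_comm _ _ _

lemma hasSum_expFin {L : ℕ} (α : Fin L → ℂ) (v : Occ L →₀ ℂ) :
    HasSum (fun k : ℕ => ((k ! : ℂ)⁻¹) • toFock L ((fieldFin α ^ k) v)) (expFin α v) :=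
  (summable_exp_series α v).of_norm.hasSum

lemma norm_expFin {L : ℕ} (α : Fin L → ℂ) (v : Occ L →₀ ℂ) :
    ‖expFin α v‖ = ‖toFock L v‖ := by
  set a : ℕ → Fock L := fun k => ((k ! : ℂ)⁻¹) • toFock L ((fieldFin α ^ k) v) with ha
  have hs := summable_exp_series α v
  have hsum2 : Summable (fun p : ℕ × ℕ => inner ℂ (a p.1) (a p.2)) := by
    refine Summable.of_norm_bounded (hs.mul_of_nonneg hs (fun _ => norm_nonneg _)
      (fun _ => norm_nonneg _)) fun p => norm_inner_le_norm _ _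
  have hA := hasSum_expFin α v
  have h1 : inner ℂ (expFin α v) (expFin α v) = ∑' p : ℕ × ℕ, inner ℂ (a p.1) (a p.2) := by
    rw [hsum2.tsum_prod]
    have e1 : ∀ j, ∑' k, inner ℂ (a j) (a k) = inner ℂ (a j) (expFin α v) := fun j =>
      ((innerSL ℂ (a j)).hasSum hA).tsum_eq
    simp only [e1]
    have := ((innerSL ℂ (expFin α v)).hasSum hA).star
    have h2 : HasSum (fun j => inner ℂ (a j) (expFin α v)) (inner ℂ (expFin α v) (expFin α v)) := by
      have g : ∀ x : Fock L, star (innerSL ℂ (expFin α v) x) = inner ℂ x (expFin α v) :=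
        fun x => by rw [innerSL_apply_apply]; exact inner_conj_symm x (expFin α v)
      simp only [g] at this
      exact this
    exact h2.tsum_eq.symm
  have h3 : ∀ N : ℕ, ∑ p ∈ Finset.HasAntidiagonal.antidiagonal N, inner ℂ (a p.1) (a p.2)
      = if N = 0 then inner ℂ (toFock L v) (toFock L v) else (0 : ℂ) := by
    intro N
    have e : ∀ p ∈ Finset.HasAntidiagonal.antidiagonal N, inner ℂ (a p.1) (a p.2)
        = ((N ! : ℂ)⁻¹ * inner ℂ (toFock L v) (toFock L ((fieldFin α ^ N) v)))
          * (N.choose p.1 • ((-1 : ℂ) ^ p.1 * 1 ^ p.2)) := by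
      intro p hp
      have hp' : p.1 + p.2 = N := Finset.HasAntidiagonal.mem_antidiagonal.1 hp
      subst hp'
      simp only [ha, inner_smul_left, inner_smul_right, fieldFin_pow_skew, map_inv₀,
        one_pow, mul_one, nsmul_eq_mul, map_natCast]
      have hch : ((p.1 + p.2).choose p.1 : ℂ) * p.1 ! * p.2 ! = (p.1 + p.2) ! := by
        rw [Nat.choose_symm_add]
        exact_mod_cast Nat.add_choose_mul_factorial_mul_factorial p.1 p.2
      have f1 : (p.1 ! : ℂ) ≠ 0 := by exact_mod_cast Nat.factorial_ne_zero _
      have f2 : (p.2 ! : ℂ) ≠ 0 := by exact_mod_cast Nat.factorial_ne_zero _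
      have f3 : ((p.1 + p.2) ! : ℂ) ≠ 0 := by exact_mod_cast Nat.factorial_ne_zero _
      rw [← hch] at f3 ⊢
      have f4 : ((p.1 + p.2).choose p.1 : ℂ) ≠ 0 := by
        intro h0; rw [h0] at f3; simp at f3
      field_simp
    rw [Finset.sum_congr rfl e, ← Finset.mul_sum, ← (Commute.all (-1 : ℂ) 1).add_pow']
    split_ifs with h0
    · subst h0; simp
    · simp [h0]
  have h4 : ∑' p : ℕ × ℕ, inner ℂ (a p.1) (a p.2) = inner ℂ (toFock L v) (toFock L v) := by
    rw [← Finset.HasAntidiagonal.sigmaAntidiagonalEquivProd.tsum_eq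
      (fun p : ℕ × ℕ => (inner ℂ (a p.1) (a p.2) : ℂ))]
    have hsig : Summable (fun c : (N : ℕ) × Finset.HasAntidiagonal.antidiagonal N =>
        (inner ℂ (a (Finset.HasAntidiagonal.sigmaAntidiagonalEquivProd c).1)
          (a (Finset.HasAntidiagonal.sigmaAntidiagonalEquivProd c).2) : ℂ)) :=
      (Equiv.summable_iff Finset.HasAntidiagonal.sigmaAntidiagonalEquivProd).2 hsum2
    rw [Summable.tsum_sigma' (fun N => (hasSum_fintype _).summable) hsig]
    rw [tsum_eq_single 0]
    · simpa using h3 0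
    · intro N hN
      have := h3 N
      rw [if_neg hN] at this
      rw [tsum_fintype, ← this]
      exact Finset.sum_coe_sort (Finset.HasAntidiagonal.antidiagonal N) (fun p => (inner ℂ (a p.1) (a p.2) : ℂ))
  have h5 : inner ℂ (expFin α v) (expFin α v) = (inner ℂ (toFock L v) (toFock L v) : ℂ) :=
    h1.trans h4
  rw [inner_self_eq_norm_sq_to_K, inner_self_eq_norm_sq_to_K] at h5
  have h6 : ‖expFin α v‖ ^ 2 = ‖toFock L v‖ ^ 2 := by exact_mod_cast h5
  exact (pow_left_inj₀ (norm_nonneg _) (norm_nonneg _) two_ne_zero).1 h6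

lemma denseRange_toFock (L : ℕ) : DenseRange (toFock L) := by
  intro ψ
  have h := lp.hasSum_single (E := fun _ : Occ L => ℂ) (p := 2) ENNReal.ofNat_ne_top ψ
  refine mem_closure_of_tendsto h (Filter.Eventually.of_forall fun s => ?_)
  refine ⟨∑ n ∈ s, Finsupp.single n (ψ n), ?_⟩
  rw [map_sum]
  refine Finset.sum_congr rfl fun n _ => ?_
  rw [toFock, Finsupp.linearCombination_single, numberVec, ← lp.single_smul, smul_eq_mul, mul_one]

/-- There is exactly one bounded operator that is the exponential of `b(α)`. -/
theorem existsUnique_exp_field {L : ℕ} (α : Fin L → ℂ) :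
    ∃! U : Fock L →L[ℂ] Fock L, IsExpOf (field α) U := by
  have hb : ∃ C, ∀ v, ‖expFin α v‖ ≤ C * ‖toFock L v‖ :=
    ⟨1, fun v => by rw [norm_expFin, one_mul]⟩
  have hs : ∀ n : Occ L, toFock L (Finsupp.single n 1) = numberVec n := by
    intro n; simp [toFock]
  refine ⟨(expFin α).extendOfNorm (toFock L), fun n m => ?_, fun V hV => ?_⟩
  · have h := (lp.evalCLM ℂ (fun _ : Occ L => ℂ) 2 m).hasSum
      (hasSum_expFin α (Finsupp.single n 1))
    rw [← hs n, LinearMap.extendOfNorm_eq (denseRange_toFock L) hb]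
    simp only [field_pow_toFock]
    exact h
  · symm
    refine LinearMap.extendOfNorm_unique (denseRange_toFock L) 1
      (fun v => by rw [norm_expFin, one_mul]) V ?_
    refine Finsupp.lhom_ext' fun n => LinearMap.ext_ring ?_
    apply lp.ext
    ext m
    have h := (lp.evalCLM ℂ (fun _ : Occ L => ℂ) 2 m).hasSum
      (hasSum_expFin α (Finsupp.single n 1))
    have h' := hV n m
    rw [← hs n] at h'
    simp only [field_pow_toFock] at h'
    exact h'.unique h

/-- The Weyl operator `D(α) = exp b(α)`. -/
noncomputable def weyl {L : ℕ} (α : Fin L → ℂ) : Fock L →L[ℂ] Fock L :=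
  (existsUnique_exp_field α).choose

lemma isExpOf_weyl {L : ℕ} (α : Fin L → ℂ) : IsExpOf (field α) (weyl α) :=
  (existsUnique_exp_field α).choose_spec.1

/-! ### States and expectation values -/

/-- The positive square root of a bounded positive operator. -/
noncomputable def opSqrt {E : Type*} [NormedAddCommGroup E] [InnerProductSpace ℂ E]
    [CompleteSpace E] (T : E →L[ℂ] E) : E →L[ℂ] E := CFC.sqrt T

/-- `ρ` is a density operator: positive with trace one. -/
structure IsDensityOperator {L : ℕ} (ρ : Fock L →L[ℂ] Fock L) : Prop where
  isPositive : ρ.IsPositive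
  hasTrace : HasSum (fun n : Occ L => inner ℂ (numberVec n) (ρ (numberVec n))) 1

/-- `ρ` commutes with the total particle number operator `N`: it maps the domain of `N` into
itself, and `N ρ ψ = ρ N ψ` for all `ψ` in the domain of `N`. -/
def CommutesWithNumber {L : ℕ} (ρ : Fock L →L[ℂ] Fock L) : Prop :=
  ∀ ψ χ : Fock L, totalNumber L (coeffs ψ) = coeffs χ →
    totalNumber L (coeffs (ρ ψ)) = coeffs (ρ χ)

/-- The expectation value `⟨O⟩ = tr[ρ O]` of a bounded operator `O`. -/
noncomputable def expect {L : ℕ} (ρ O : Fock L →L[ℂ] Fock L) : ℂ :=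
  ∑' n : Occ L, inner ℂ (numberVec n) (ρ (O (numberVec n)))

/-- The diagonal matrix elements `⟨n| √ρ O √ρ |n⟩` for an unbounded operator `O`.  When `ρ`
commutes with the total particle number, `√ρ |n⟩` is a finite linear combination of number basis
vectors, and the sum over `m` is finite. -/
noncomputable def momentTerm {L : ℕ} (ρ : Fock L →L[ℂ] Fock L) (O : Module.End ℂ (Coeff L))
    (n : Occ L) : ℂ :=
  ∑' m : Occ L, conj ((coeffs (opSqrt ρ (numberVec n))) m) *
    O (coeffs (opSqrt ρ (numberVec n))) m

/-- The expectation value `⟨O⟩ = tr[ρ O]` of an unbounded operator `O`, understood, as usual, as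
the trace of `√ρ O √ρ`. -/
noncomputable def moment {L : ℕ} (ρ : Fock L →L[ℂ] Fock L) (O : Module.End ℂ (Coeff L)) : ℂ :=
  ∑' n : Occ L, momentTerm ρ O n

/-- The second moments `σ(α, α') = ⟨b(α) b(α')⟩`. -/
noncomputable def secondMoment {L : ℕ} (ρ : Fock L →L[ℂ] Fock L) (α α' : Fin L → ℂ) : ℂ :=
  moment ρ (field α * field α')

/-- The fourth moment `f(α) = ⟨b(α)⁴⟩`. -/
noncomputable def fourthMoment {L : ℕ} (ρ : Fock L →L[ℂ] Fock L) (α : Fin L → ℂ) : ℂ :=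
  moment ρ (field α ^ 4)

/-- `f(α) < ∞`.  The terms of the series are the numbers `‖b(α)² √ρ |n⟩‖²` for states that commute
with the total particle number, so that convergence and absolute convergence agree. -/
def FourthMomentFinite {L : ℕ} (ρ : Fock L →L[ℂ] Fock L) (α : Fin L → ℂ) : Prop :=
  Summable (momentTerm ρ (field α ^ 4))

end BosonChain

namespace BosonChain

open scoped ComplexConjugate Nat

/-! ### Analytic preliminaries -/

/-! Everything reduces to one block. The expectations of the Weyl operators and the Gaussian factors
all lie in the closed unit disc, so the difference of the two products telescopes into the sum of
the differences of the factors.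

For one block write `b` for the field operator. Number conservation makes each `√ρ |n⟩` a finite
vector `v` of fixed particle number (`exists_toFock_eq_opSqrt`), so the exponential series for `⟨v,
D v⟩` can be handled term by term. Since `b` flips the parity of the particle number, odd orders
vanish; orders 0 and 2 give `‖v‖² + ⟨v, b² v⟩ / 2`. As `b` is anti-hermitian, the tail is `∑ ⟨w, b^k
w⟩ / (k+4)!` with `w = b² v`, the fourfold integral of `t ↦ ⟨w, D(tα) w⟩` evaluated at `t = 1`.
Isometry of `D(tα)` bounds that function by `‖w‖²`, and the tail by `‖w‖² / 24`
(`norm_inner_weyl_sub_le`).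

Summing over `n` gives `|⟨D⟩ - (1 - s/2)| ≤ f/24`, where `s = -σ ≥ 0` (`IsDensityOperator.moments`).
Cauchy-Schwarz gives `s² ≤ f`, so replacing `1 - s/2` by `exp(-s/2)` costs at most `s²/8 ≤ f/8`. The
total `f/6` is within the stated `7f/24`. -/

/-- Products of numbers in the closed unit disc differ by at most the sum of the differences of
their factors. -/
lemma norm_prod_sub_prod_le_sum {ι : Type*} (s : Finset ι) (a b : ι → ℂ)
    (ha : ∀ i ∈ s, ‖a i‖ ≤ 1) (hb : ∀ i ∈ s, ‖b i‖ ≤ 1) :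
    ‖∏ i ∈ s, a i - ∏ i ∈ s, b i‖ ≤ ∑ i ∈ s, ‖a i - b i‖ := by
  classical
  induction s using Finset.induction_on with
  | empty => simp
  | insert i s hi ih =>
    rw [Finset.prod_insert hi, Finset.prod_insert hi, Finset.sum_insert hi]
    have ih' := ih (fun j hj => ha j (Finset.mem_insert_of_mem hj))
      (fun j hj => hb j (Finset.mem_insert_of_mem hj))
    have hp : ‖∏ j ∈ s, b j‖ ≤ 1 := by
      rw [norm_prod]
      exact Finset.prod_le_one (fun _ _ => norm_nonneg _)
        fun j hj => hb j (Finset.mem_insert_of_mem hj)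
    have e : a i * ∏ j ∈ s, a j - b i * ∏ j ∈ s, b j
        = a i * (∏ j ∈ s, a j - ∏ j ∈ s, b j) + (a i - b i) * ∏ j ∈ s, b j := by ring
    rw [e]
    refine (norm_add_le _ _).trans ?_
    rw [norm_mul, norm_mul]
    have h1 := mul_le_mul (ha i (Finset.mem_insert_self i s)) ih' (norm_nonneg _) zero_le_one
    have h2 := mul_le_mul_of_nonneg_left hp (norm_nonneg (a i - b i))
    linarith

/-- Integrating a bound on an exponential generating series `j` times. -/
lemma norm_tsum_pow_div_factorial_le (c : ℕ → ℂ) (C : ℝ)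
    (hc : Summable fun k : ℕ => ‖c k‖ / (k ! : ℝ))
    (hC : ∀ t : ℝ, 0 ≤ t → t ≤ 1 → ‖∑' k : ℕ, c k * (t : ℂ) ^ k / (k ! : ℂ)‖ ≤ C) (j : ℕ) :
    ∀ t : ℝ, 0 ≤ t → t ≤ 1 →
      ‖∑' k : ℕ, c k * (t : ℂ) ^ (k + j) / ((k + j)! : ℂ)‖ ≤ C * t ^ j / j ! := by
  induction j with
  | zero => simpa using hC
  | succ j ih =>
    intro t ht0 ht1
    -- A majorant uniform in `s` and independent of `j`, since `(k + j)! ≥ k!`; it licenses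
    -- integrating the series termwise over `[0, t]`.
    have hb : ∀ (k : ℕ) (s : ℝ), 0 ≤ s → s ≤ 1 →
        ‖c k * (s : ℂ) ^ (k + j) / ((k + j)! : ℂ)‖ ≤ ‖c k‖ / (k ! : ℝ) := by
      intro k s hs0 hs1
      rw [norm_div, norm_mul, norm_pow, Complex.norm_natCast, Complex.norm_real,
        Real.norm_of_nonneg hs0]
      have h1 : s ^ (k + j) ≤ 1 := pow_le_one₀ hs0 hs1
      have h2 : (k ! : ℝ) ≤ ((k + j)! : ℝ) := by
        exact_mod_cast Nat.factorial_le (Nat.le_add_right k j)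
      have h3 : (0 : ℝ) < (k ! : ℝ) := by positivity
      exact div_le_div₀ (norm_nonneg _) (mul_le_of_le_one_right (norm_nonneg _) h1) h3 h2
    have hint := intervalIntegral.hasSum_integral_of_dominated_convergence
      (μ := MeasureTheory.volume) (a := 0) (b := t)
      (F := fun (k : ℕ) (s : ℝ) => c k * (s : ℂ) ^ (k + j) / ((k + j)! : ℂ))
      (f := fun s : ℝ => ∑' k : ℕ, c k * (s : ℂ) ^ (k + j) / ((k + j)! : ℂ))
      (fun k _ => ‖c k‖ / (k ! : ℝ))
      (fun k => (by fun_prop : Continuous fun s : ℝ =>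
        c k * (s : ℂ) ^ (k + j) / ((k + j)! : ℂ)).aestronglyMeasurable)
      (fun k => Filter.Eventually.of_forall fun s hs => by
        rw [Set.uIoc_of_le ht0] at hs
        exact hb k s hs.1.le (hs.2.trans ht1))
      (Filter.Eventually.of_forall fun s _ => hc)
      (by simp)
      (Filter.Eventually.of_forall fun s hs => by
        rw [Set.uIoc_of_le ht0] at hs
        exact (Summable.of_norm_bounded hc
          fun k => hb k s hs.1.le (hs.2.trans ht1)).hasSum)
    have hterm : ∀ k : ℕ, ∫ s in (0 : ℝ)..t, c k * (s : ℂ) ^ (k + j) / ((k + j)! : ℂ)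
        = c k * (t : ℂ) ^ (k + (j + 1)) / ((k + (j + 1))! : ℂ) := by
      intro k
      have : ∀ s : ℝ, c k * (s : ℂ) ^ (k + j) / ((k + j)! : ℂ)
          = (c k / ((k + j)! : ℂ)) * ((s ^ (k + j) : ℝ) : ℂ) := by
        intro s; push_cast; ring
      simp only [this]
      rw [intervalIntegral.integral_const_mul, intervalIntegral.integral_ofReal, integral_pow,
        ← add_assoc, Nat.factorial_succ]
      have f1 : (((k + j)! : ℕ) : ℂ) ≠ 0 := by exact_mod_cast Nat.factorial_ne_zero _
      have f2 : ((k : ℂ) + j + 1) ≠ 0 := by exact_mod_cast Nat.succ_ne_zero (k + j)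
      push_cast
      simp only [ne_eq, Nat.succ_ne_zero, not_false_eq_true, zero_pow, sub_zero]
      field_simp
    simp only [hterm] at hint
    rw [hint.tsum_eq]
    refine (intervalIntegral.norm_integral_le_of_norm_le ht0
      (g := fun s => C * s ^ j / j !) (Filter.Eventually.of_forall fun s hs =>
        ih s hs.1.le (hs.2.trans ht1)) ?_).trans ?_
    · exact (by fun_prop : Continuous fun s : ℝ => C * s ^ j / (j ! : ℝ)).intervalIntegrable _ _
    · have : ∀ s : ℝ, C * s ^ j / (j ! : ℝ) = (C / j !) * s ^ j := fun s => by ring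
      simp only [this]
      rw [intervalIntegral.integral_const_mul, integral_pow, Nat.factorial_succ]
      apply le_of_eq
      push_cast
      simp only [ne_eq, Nat.succ_ne_zero, not_false_eq_true, zero_pow, sub_zero]
      field_simp

/-- The second order estimate for the real exponential on the negative half-line. -/
lemma norm_exp_neg_sub_one_add_le {x : ℝ} (hx : 0 ≤ x) :
    |Real.exp (-x) - (1 - x)| ≤ x ^ 2 / 2 := by
  have h1 := Real.add_one_le_exp (-x)
  have h2 := Real.quadratic_le_exp_of_nonneg hx
  have h3 := Real.exp_pos x
  rw [abs_of_nonneg (by linarith), Real.exp_neg]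
  have h4 : (Real.exp x)⁻¹ ≤ (1 + x + x ^ 2 / 2)⁻¹ := inv_anti₀ (by positivity) h2
  have h5 : (1 + x + x ^ 2 / 2)⁻¹ ≤ 1 - x + x ^ 2 / 2 := by
    -- The product `(1 + x + x²/2)(1 - x + x²/2)` equals `1 + x⁴/4`.
    rw [inv_le_iff_one_le_mul₀ (by positivity)]
    nlinarith [sq_nonneg (x ^ 2)]
  linarith

/-! ### The Weyl operators are contractions -/

lemma coeffs_injective {L : ℕ} : Function.Injective (coeffs (L := L)) :=
  fun _ _ h => lp.ext h

lemma toFock_single {L : ℕ} (n : Occ L) (c : ℂ) :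
    toFock L (Finsupp.single n c) = c • numberVec n := by
  simp [toFock]

lemma inner_numberVec_left {L : ℕ} (n : Occ L) (ψ : Fock L) :
    inner ℂ (numberVec n) ψ = ψ n := by
  rw [numberVec, lp.inner_single_left]; simp

/-- `weyl` is specified only through its matrix elements in the number basis; comparing coefficients
identifies it with the norm-convergent series on finite vectors. -/
lemma weyl_toFock {L : ℕ} (α : Fin L → ℂ) (v : Occ L →₀ ℂ) :
    weyl α (toFock L v) = expFin α v := by
  induction v using Finsupp.induction_linear with
  | zero => simp
  | add v w hv hw => simp only [map_add, hv, hw]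
  | single n c =>
    have hc : Finsupp.single n c = c • Finsupp.single n (1 : ℂ) := by simp
    rw [hc]
    simp only [map_smul]
    congr 1
    apply lp.ext
    ext m
    have h := (lp.evalCLM ℂ (fun _ : Occ L => ℂ) 2 m).hasSum
      (hasSum_expFin α (Finsupp.single n 1))
    have h' := isExpOf_weyl α n m
    rw [show numberVec n = toFock L (Finsupp.single n 1) by simp [toFock]] at h'
    simp only [field_pow_toFock] at h'
    exact h'.unique h

lemma norm_weyl_apply {L : ℕ} (α : Fin L → ℂ) (ψ : Fock L) : ‖weyl α ψ‖ = ‖ψ‖ := by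
  refine (denseRange_toFock L).induction_on ψ (isClosed_eq (by fun_prop) (by fun_prop)) fun v => ?_
  rw [weyl_toFock, norm_expFin]

/-- The scalar has to be real, because `b(α)` is only real-linear in `α`. This turns powers of `t`
in the series into the Weyl operator at `tα`. -/
lemma fieldFin_real_smul {L : ℕ} (t : ℝ) (α : Fin L → ℂ) :
    fieldFin (fun i => (t : ℂ) * α i) = (t : ℂ) • fieldFin α := by
  refine Finsupp.lhom_ext' fun n => LinearMap.ext_ring ?_
  simp only [LinearMap.comp_apply, Finsupp.lsingle_apply, LinearMap.smul_apply, fieldFin,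
    Finsupp.linearCombination_single, one_smul, fieldVec, Finset.smul_sum, smul_sub,
    Finsupp.smul_single, smul_eq_mul, map_mul, Complex.conj_ofReal, mul_assoc]

/-! ### Parity -/

/-- Finite linear combinations of number basis vectors whose total particle number plus `p` is
even. -/
noncomputable def paritySubmodule (L p : ℕ) : Submodule ℂ (Occ L →₀ ℂ) :=
  Finsupp.supported ℂ ℂ {n | Even (∑ i, n i + p)}

lemma sum_update_add {L : ℕ} (n : Occ L) (i : Fin L) (a : ℕ) :
    ∑ l, Function.update n i a l + n i = ∑ l, n l + a := by
  rw [Finset.sum_update_of_mem (Finset.mem_univ i), Finset.sdiff_singleton_eq_erase,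
    ← Finset.add_sum_erase Finset.univ n (Finset.mem_univ i)]
  ring

/-- Each term of the field operator creates or annihilates exactly one particle, which flips the
parity. -/
lemma fieldFin_mem_paritySubmodule {L : ℕ} (α : Fin L → ℂ) {p : ℕ} {v : Occ L →₀ ℂ}
    (hv : v ∈ paritySubmodule L p) : fieldFin α v ∈ paritySubmodule L (p + 1) := by
  rw [fieldFin, Finsupp.linearCombination_apply]
  refine Submodule.sum_mem _ fun n hn => Submodule.smul_mem _ _ ?_
  have hn' : Even (∑ i, n i + p) := (Finsupp.mem_supported ℂ v).1 hv hn
  refine Submodule.sum_mem _ fun i _ => Submodule.sub_mem _ ?_ ?_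
  · refine Finsupp.single_mem_supported ℂ _ ?_
    have := sum_update_add n i (n i + 1)
    change Even _
    grind
  -- At `n i = 0` the truncated `n i - 1` would leave the parity unchanged, but the coefficient `√(n
  -- i)` kills that term.
  · rcases Nat.eq_zero_or_pos (n i) with h0 | h0
    · simp [h0]
    · refine Finsupp.single_mem_supported ℂ _ ?_
      have := sum_update_add n i (n i - 1)
      change Even _
      grind

lemma fieldFin_pow_mem_paritySubmodule {L : ℕ} (α : Fin L → ℂ) {p : ℕ} {v : Occ L →₀ ℂ}
    (hv : v ∈ paritySubmodule L p) (k : ℕ) : (fieldFin α ^ k) v ∈ paritySubmodule L (p + k) := by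
  induction k with
  | zero => simpa
  | succ k ih =>
    rw [pow_succ', Module.End.mul_apply, ← add_assoc]
    exact fieldFin_mem_paritySubmodule α ih

lemma coeffs_toFock {L : ℕ} (v : Occ L →₀ ℂ) (n : Occ L) : coeffs (toFock L v) n = v n := by
  induction v using Finsupp.induction_linear with
  | zero => simp
  | add v w hv hw => simp only [map_add, Pi.add_apply, Finsupp.add_apply, hv, hw]
  | single m c =>
    rw [toFock_single, map_smul, Pi.smul_apply, numberVec_apply, Finsupp.single_apply]
    simp [eq_comm]

lemma inner_toFock_eq_zero_of_parity {L : ℕ} {p : ℕ} {v w : Occ L →₀ ℂ}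
    (hv : v ∈ paritySubmodule L p) (hw : w ∈ paritySubmodule L (p + 1)) :
    inner ℂ (toFock L v) (toFock L w) = 0 := by
  rw [lp.inner_eq_tsum]
  refine (tsum_congr fun n => ?_).trans tsum_zero
  have h1 : toFock L v n = v n := coeffs_toFock v n
  have h2 : toFock L w n = w n := coeffs_toFock w n
  rw [h1, h2]
  by_cases hn : Even (∑ i, n i + p)
  · have : w n = 0 := by
      by_contra h
      have : Even (∑ i, n i + (p + 1)) :=
        (Finsupp.mem_supported ℂ w).1 hw (Finsupp.mem_support_iff.2 h)
      grind
    simp [this]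
  · have : v n = 0 := by
      by_contra h
      exact hn ((Finsupp.mem_supported ℂ v).1 hv (Finsupp.mem_support_iff.2 h))
    simp [this]

lemma inner_fieldFin_odd_pow {L : ℕ} (α : Fin L → ℂ) {p : ℕ} {v : Occ L →₀ ℂ}
    (hv : v ∈ paritySubmodule L p) {k : ℕ} (hk : Odd k) :
    inner ℂ (toFock L v) (toFock L ((fieldFin α ^ k) v)) = 0 := by
  refine inner_toFock_eq_zero_of_parity hv ?_
  obtain ⟨j, rfl⟩ := hk
  have h := fieldFin_pow_mem_paritySubmodule α hv (2 * j + 1)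
  -- The offsets `p + (2 * j + 1)` and `p + 1` differ by an even number, so both describe the same
  -- parity class.
  rw [paritySubmodule, Finsupp.mem_supported] at h ⊢
  intro n hn
  have := h hn
  simp only [Set.mem_ofPred_eq] at this ⊢
  grind

/-! ### Fourth order expansion of the characteristic function on number-parity eigenvectors -/

/-- The series is `⟨w, D(tα) w⟩`, so Cauchy-Schwarz and the isometry of the exponential bound it
uniformly in `t`. -/
lemma norm_tsum_inner_fieldFin_pow_le {L : ℕ} (α : Fin L → ℂ) (w : Occ L →₀ ℂ) (t : ℝ) :
    ‖∑' k : ℕ, inner ℂ (toFock L w) (toFock L ((fieldFin α ^ k) w)) * (t : ℂ) ^ k / (k ! : ℂ)‖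
      ≤ ‖toFock L w‖ ^ 2 := by
  have h := (innerSL ℂ (toFock L w)).hasSum (hasSum_expFin (fun i => (t : ℂ) * α i) w)
  have e : ∀ k : ℕ, inner ℂ (toFock L w) (toFock L ((fieldFin α ^ k) w)) * (t : ℂ) ^ k / (k ! : ℂ)
      = innerSL ℂ (toFock L w)
        (((k ! : ℂ)⁻¹) • toFock L ((fieldFin (fun i => (t : ℂ) * α i) ^ k) w)) := by
    intro k
    rw [fieldFin_real_smul, smul_pow, LinearMap.smul_apply, innerSL_apply_apply, inner_smul_right,
      map_smul, inner_smul_right]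
    ring
  rw [tsum_congr e]
  refine h.tsum_eq ▸ ?_
  rw [innerSL_apply_apply, sq]
  refine (norm_inner_le_norm _ _).trans_eq ?_
  rw [norm_expFin]

lemma summable_inner_fieldFin_pow {L : ℕ} (α : Fin L → ℂ) (w : Occ L →₀ ℂ) :
    Summable fun k : ℕ =>
      ‖(inner ℂ (toFock L w) (toFock L ((fieldFin α ^ k) w)) : ℂ)‖ / (k ! : ℝ) := by
  refine Summable.of_nonneg_of_le (fun k => by positivity) (fun k => ?_)
    ((summable_exp_series α w).mul_left ‖toFock L w‖)
  rw [norm_smul, norm_inv, Complex.norm_natCast, div_eq_inv_mul, mul_left_comm]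
  gcongr
  exact norm_inner_le_norm _ _

/-- Taylor's formula with integral remainder of order four; the orders 1 and 3 drop out by parity.
-/
lemma norm_inner_weyl_sub_le {L : ℕ} (α : Fin L → ℂ) {p : ℕ} {v : Occ L →₀ ℂ}
    (hv : v ∈ paritySubmodule L p) :
    ‖inner ℂ (toFock L v) (weyl α (toFock L v)) - inner ℂ (toFock L v) (toFock L v)
        - inner ℂ (toFock L v) (toFock L ((fieldFin α ^ 2) v)) / 2‖
      ≤ ‖toFock L ((fieldFin α ^ 2) v)‖ ^ 2 / 24 := by
  set w := (fieldFin α ^ 2) v with hw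
  have h := (innerSL ℂ (toFock L v)).hasSum (hasSum_expFin α v)
  rw [← weyl_toFock, innerSL_apply_apply, ← hasSum_nat_add_iff' 4] at h
  have o1 := inner_fieldFin_odd_pow α hv (k := 1) (by decide)
  have o3 := inner_fieldFin_odd_pow α hv (k := 3) (by decide)
  -- Two of the `k + 4` factors are moved to the left slot, with sign `(-1)² = 1`. The factor `1 ^
  -- (k + 4)` matches the integrated series at `t = 1`.
  have e : ∀ k : ℕ, innerSL ℂ (toFock L v)
      ((((k + 4)! : ℕ) : ℂ)⁻¹ • toFock L ((fieldFin α ^ (k + 4)) v))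
      = inner ℂ (toFock L w) (toFock L ((fieldFin α ^ k) w)) * ((1 : ℝ) : ℂ) ^ (k + 4)
        / ((k + 4)! : ℂ) := by
    intro k
    have h2 : (fieldFin α ^ k) w = (fieldFin α ^ (k + 2)) v := by
      rw [hw, pow_add]; rfl
    rw [h2, hw, fieldFin_pow_skew, innerSL_apply_apply, inner_smul_right,
      show 2 + (k + 2) = k + 4 by ring]
    simp
    ring
  have h4 := norm_tsum_pow_div_factorial_le _ _ (summable_inner_fieldFin_pow α w)
    (fun t _ _ => norm_tsum_inner_fieldFin_pow_le α w t) 4 1 zero_le_one le_rfl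
  rw [← tsum_congr e, h.tsum_eq] at h4
  simp only [Finset.sum_range_succ, Finset.sum_range_zero, innerSL_apply_apply, inner_smul_right,
    o1, o3, ← hw] at h4
  simp only [Nat.factorial, pow_zero, Module.End.one_apply] at h4
  convert h4 using 1
  · congr 1
    push_cast
    ring
  · push_cast
    ring

/-! ### Conservation of the particle number -/

lemma totalNumber_apply {L : ℕ} (ψ : Coeff L) (m : Occ L) :
    totalNumber L ψ m = ((∑ i, m i : ℕ) : ℂ) * ψ m := by
  rw [totalNumber, LinearMap.sum_apply, Finset.sum_apply, Nat.cast_sum, Finset.sum_mul]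
  refine Finset.sum_congr rfl fun i _ => ?_
  simp only [Module.End.mul_apply, create, annihilate, LinearMap.coe_mk, AddHom.coe_mk]
  rcases Nat.eq_zero_or_pos (m i) with h0 | h0
  · simp [h0]
  · have h1 : m i - 1 + 1 = m i := Nat.sub_add_cancel h0
    have h2 : (((m i - 1 : ℕ) : ℝ) + 1) = m i := by exact_mod_cast h1
    simp only [Function.update_self, Function.update_idem, h1, Function.update_eq_self, h2]
    rw [← mul_assoc, ← Complex.ofReal_mul, Real.mul_self_sqrt (Nat.cast_nonneg _)]
    simp

/-- The projection onto the states with `k` particles. -/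
noncomputable def sectorProj (L k : ℕ) : Fock L →L[ℂ] Fock L :=
  ∑ m ∈ Finset.piAntidiag Finset.univ k,
    (lp.evalCLM ℂ (fun _ : Occ L => ℂ) 2 m).smulRight (numberVec m)

lemma sectorProj_eq_toFock {L : ℕ} (k : ℕ) (ψ : Fock L) :
    sectorProj L k ψ
      = toFock L (∑ m ∈ Finset.piAntidiag Finset.univ k, Finsupp.single m (ψ m)) := by
  simp only [sectorProj, map_sum, toFock_single, _root_.sum_apply]
  rfl

lemma sectorProj_apply {L : ℕ} (k : ℕ) (ψ : Fock L) (n : Occ L) :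
    coeffs (sectorProj L k ψ) n = if ∑ i, n i = k then ψ n else 0 := by
  rw [sectorProj_eq_toFock, coeffs_toFock, Finsupp.finsetSum_apply]
  simp [Finsupp.single_apply, Finset.mem_piAntidiag]

/-- `ρ |n⟩` is again an eigenvector of the number operator for the eigenvalue of `|n⟩`, so it has no
components in other sectors. -/
lemma CommutesWithNumber.coeffs_eq_zero {L : ℕ} {ρ : Fock L →L[ℂ] Fock L}
    (hN : CommutesWithNumber ρ) {n m : Occ L} (h : ∑ i, m i ≠ ∑ i, n i) :
    coeffs (ρ (numberVec n)) m = 0 := by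
  have h1 := hN (numberVec n) (((∑ i, n i : ℕ) : ℂ) • numberVec n) (by
    ext m
    rw [totalNumber_apply, map_smul, Pi.smul_apply, smul_eq_mul, numberVec_apply]
    split_ifs with hm
    · rw [hm]
    · simp)
  have h2 := congrFun h1 m
  rw [totalNumber_apply, map_smul, map_smul, Pi.smul_apply, smul_eq_mul] at h2
  have h3 : ((∑ i, m i : ℕ) : ℂ) ≠ ((∑ i, n i : ℕ) : ℂ) := by exact_mod_cast h
  exact (mul_eq_mul_right_iff.1 h2).resolve_left h3

/-- Replaces the unbounded number operator by its bounded spectral projections, so that commutation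
passes to `√ρ` through the continuous functional calculus. -/
lemma CommutesWithNumber.commute_sectorProj {L : ℕ} {ρ : Fock L →L[ℂ] Fock L}
    (hN : CommutesWithNumber ρ) (k : ℕ) : Commute ρ (sectorProj L k) := by
  refine ContinuousLinearMap.ext fun ψ => ?_
  refine (denseRange_toFock L).induction_on ψ (isClosed_eq (by fun_prop) (by fun_prop)) fun v => ?_
  induction v using Finsupp.induction_linear with
  | zero => simp
  | add v w hv hw => simp only [map_add, hv, hw]
  | single n c =>
    rw [toFock_single, map_smul, map_smul]
    congr 1
    have hP : sectorProj L k (numberVec n) = if ∑ i, n i = k then numberVec n else 0 := by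
      apply coeffs_injective
      ext m
      rw [sectorProj_apply]
      have := numberVec_apply n m
      change numberVec n m = _ at this
      rw [this]
      by_cases hm : m = n
      · subst hm
        rw [if_pos rfl]
        split_ifs <;> simp [numberVec_apply]
      · rw [if_neg hm]
        split_ifs <;> simp [numberVec_apply, hm]
    change ρ (sectorProj L k (numberVec n)) = sectorProj L k (ρ (numberVec n))
    rw [hP]
    apply coeffs_injective
    ext m
    rw [sectorProj_apply]
    change _ = if _ then coeffs (ρ (numberVec n)) m else 0
    by_cases hm : ∑ i, m i = ∑ i, n i
    · rw [hm]
      split_ifs <;> simp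
    · rw [hN.coeffs_eq_zero hm, ite_self]
      split_ifs
      · exact hN.coeffs_eq_zero hm
      · simp

lemma opSqrt_commute {E : Type*} [NormedAddCommGroup E] [InnerProductSpace ℂ E]
    [CompleteSpace E] {ρ T : E →L[ℂ] E} (h : Commute ρ T) : Commute (opSqrt ρ) T :=
  Commute.cfcₙ_nnreal h _

/-- `√ρ` preserves every sector, and a sector is spanned by finitely many number basis vectors. The
offset `∑ i, n i` fits the parity convention because a number added to itself is even. -/
lemma exists_toFock_eq_opSqrt {L : ℕ} {ρ : Fock L →L[ℂ] Fock L} (hN : CommutesWithNumber ρ)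
    (n : Occ L) :
    ∃ v ∈ paritySubmodule L (∑ i, n i), toFock L v = opSqrt ρ (numberVec n) := by
  set k := ∑ i, n i with hk
  refine ⟨∑ m ∈ Finset.piAntidiag Finset.univ k,
    Finsupp.single m (opSqrt ρ (numberVec n) m), ?_, ?_⟩
  · refine Submodule.sum_mem _ fun m hm => Finsupp.single_mem_supported ℂ _ ?_
    have : ∑ i, m i = k := (Finset.mem_piAntidiag.1 hm).1
    change Even _
    rw [this]
    exact Even.add_self k
  · rw [← sectorProj_eq_toFock]
    have h : opSqrt ρ (sectorProj L k (numberVec n)) = sectorProj L k (opSqrt ρ (numberVec n)) :=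
      DFunLike.congr_fun (opSqrt_commute (hN.commute_sectorProj k)) (numberVec n)
    rw [← h]
    congr 1
    apply coeffs_injective
    ext m
    rw [sectorProj_apply]
    change (if _ then coeffs (numberVec n) m else 0) = _
    rw [numberVec_apply]
    by_cases hm : m = n
    · subst hm; simp [hk]
    · simp [hm]

/-! ### The square root of the state -/

lemma opSqrt_mul_self {E : Type*} [NormedAddCommGroup E] [InnerProductSpace ℂ E]
    [CompleteSpace E] {ρ : E →L[ℂ] E} (hρ : ρ.IsPositive) (ψ : E) :
    opSqrt ρ (opSqrt ρ ψ) = ρ ψ :=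
  DFunLike.congr_fun (CFC.sqrt_mul_sqrt_self ρ
    ((ContinuousLinearMap.nonneg_iff_isPositive ρ).2 hρ)) ψ

lemma inner_opSqrt_left {E : Type*} [NormedAddCommGroup E] [InnerProductSpace ℂ E]
    [CompleteSpace E] (ρ : E →L[ℂ] E) (ψ χ : E) :
    inner ℂ (opSqrt ρ ψ) χ = inner ℂ ψ (opSqrt ρ χ) :=
  ((ContinuousLinearMap.nonneg_iff_isPositive _).1 (CFC.sqrt_nonneg ρ)).isSymmetric ψ χ

lemma IsDensityOperator.hasSum_norm_opSqrt {L : ℕ} {ρ : Fock L →L[ℂ] Fock L}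
    (hρ : IsDensityOperator ρ) :
    HasSum (fun n : Occ L => ‖opSqrt ρ (numberVec n)‖ ^ 2) 1 := by
  have h := hρ.hasTrace
  have e : ∀ n : Occ L, (inner ℂ (numberVec n) (ρ (numberVec n)) : ℂ)
      = ((‖opSqrt ρ (numberVec n)‖ ^ 2 : ℝ) : ℂ) := by
    intro n
    rw [← opSqrt_mul_self hρ.isPositive, ← inner_opSqrt_left, inner_self_eq_norm_sq_to_K]
    simp
  simp only [e] at h
  rw [← Complex.ofReal_one] at h
  exact Complex.hasSum_ofReal.1 h

lemma hasSum_norm_sq_coeff {L : ℕ} (ψ : Fock L) : HasSum (fun n => ‖ψ n‖ ^ 2) (‖ψ‖ ^ 2) := by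
  have h := lp.hasSum_norm (p := 2) (by simp) ψ
  simpa using h

/-- The Hilbert-Schmidt property read off the matrix elements, as needed to exchange the double sum
in the trace. -/
lemma summable_norm_sq_matrix {L : ℕ} {T : Fock L →L[ℂ] Fock L}
    (h : Summable fun n : Occ L => ‖T (numberVec n)‖ ^ 2) :
    Summable fun q : Occ L × Occ L => ‖T (numberVec q.1) q.2‖ ^ 2 := by
  have hs : ∀ n : Occ L, HasSum (fun m => ‖T (numberVec n) m‖ ^ 2) (‖T (numberVec n)‖ ^ 2) :=
    fun n => hasSum_norm_sq_coeff (T (numberVec n))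
  have hnn : 0 ≤ fun q : Occ L × Occ L => ‖T (numberVec q.1) q.2‖ ^ 2 :=
    fun q => sq_nonneg _
  rw [summable_prod_of_nonneg hnn]
  refine ⟨fun n => (hs n).summable, h.congr fun n => ?_⟩
  exact (hs n).tsum_eq.symm

/-- Cyclicity of the trace, in the form `tr[ρ O] = tr[√ρ O √ρ]`. -/
lemma IsDensityOperator.expect_eq {L : ℕ} {ρ : Fock L →L[ℂ] Fock L} (hρ : IsDensityOperator ρ)
    (O : Fock L →L[ℂ] Fock L) :
    expect ρ O = ∑' n : Occ L,
      inner ℂ (opSqrt ρ (numberVec n)) (O (opSqrt ρ (numberVec n))) := by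
  set S := opSqrt ρ with hS
  -- `B = O† √ρ` is Hilbert-Schmidt along with `√ρ`, and its conjugated matrix elements are those of
  -- `√ρ O`. The trace becomes a double sum of products of two square-summable families, whose order
  -- can be exchanged.
  set B : Fock L →L[ℂ] Fock L := (ContinuousLinearMap.adjoint O) ∘L S with hB
  have hsS := hρ.hasSum_norm_opSqrt.summable
  have hsB : Summable fun n : Occ L => ‖B (numberVec n)‖ ^ 2 := by
    refine Summable.of_nonneg_of_le (fun n => by positivity) (fun n => ?_)
      (hsS.mul_left (‖ContinuousLinearMap.adjoint O‖ ^ 2))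
    rw [← mul_pow]
    gcongr
    exact (ContinuousLinearMap.adjoint O).le_opNorm _
  have e : ∀ n m : Occ L, S (numberVec n) m = conj (S (numberVec m) n) := by
    intro n m
    rw [← inner_numberVec_left, ← inner_numberVec_left, inner_conj_symm, hS, inner_opSqrt_left]
  have e' : ∀ n m : Occ L, S (O (numberVec n)) m = conj (B (numberVec m) n) := by
    intro n m
    rw [← inner_numberVec_left, ← inner_numberVec_left, inner_conj_symm, hS, ← inner_opSqrt_left,
      hB, ContinuousLinearMap.comp_apply, ContinuousLinearMap.adjoint_inner_left]
  have hsum : Summable fun q : Occ L × Occ L =>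
      S (numberVec q.1) q.2 * conj (B (numberVec q.1) q.2) := by
    refine Summable.of_norm_bounded ((summable_norm_sq_matrix hsS).add
      (summable_norm_sq_matrix hsB)) fun q => ?_
    rw [norm_mul, RCLike.norm_conj]
    nlinarith [sq_nonneg (‖S (numberVec q.1) q.2‖ - ‖B (numberVec q.1) q.2‖),
      sq_nonneg (‖S (numberVec q.1) q.2‖), sq_nonneg (‖B (numberVec q.1) q.2‖)]
  have h1 : expect ρ O = ∑' n, ∑' m, S (numberVec m) n * conj (B (numberVec m) n) := by
    refine tsum_congr fun n => ?_
    rw [← opSqrt_mul_self hρ.isPositive, ← inner_opSqrt_left, lp.inner_eq_tsum]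
    refine tsum_congr fun m => ?_
    rw [← hS, e', e n m, RCLike.inner_apply, Complex.conj_conj, mul_comm]
  have h2 : ∀ m, ∑' n, S (numberVec m) n * conj (B (numberVec m) n)
      = inner ℂ (S (numberVec m)) (O (S (numberVec m))) := by
    intro m
    rw [← ContinuousLinearMap.adjoint_inner_left, lp.inner_eq_tsum]
    exact tsum_congr fun n => (RCLike.inner_apply _ _).symm
  rw [h1, Summable.tsum_comm (f := fun m n => S (numberVec m) n * conj (B (numberVec m) n)) hsum]
  exact tsum_congr h2

/-! ### Moments -/

lemma momentTerm_field_pow {L : ℕ} {ρ : Fock L →L[ℂ] Fock L} (α : Fin L → ℂ) (k : ℕ) {n : Occ L}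
    {v : Occ L →₀ ℂ} (hv : toFock L v = opSqrt ρ (numberVec n)) :
    momentTerm ρ (field α ^ k) n = inner ℂ (toFock L v) (toFock L ((fieldFin α ^ k) v)) := by
  rw [momentTerm, ← hv, field_pow_toFock, lp.inner_eq_tsum]
  exact tsum_congr fun m => by rw [RCLike.inner_apply, mul_comm]; rfl

lemma momentTerm_field_sq {L : ℕ} {ρ : Fock L →L[ℂ] Fock L} (α : Fin L → ℂ) {n : Occ L}
    {v : Occ L →₀ ℂ} (hv : toFock L v = opSqrt ρ (numberVec n)) :
    momentTerm ρ (field α ^ 2) n = -((‖toFock L (fieldFin α v)‖ ^ 2 : ℝ) : ℂ) := by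
  rw [momentTerm_field_pow α 2 hv]
  have h := fieldFin_pow_skew α 1 1 v v
  rw [pow_one, inner_self_eq_norm_sq_to_K, pow_one] at h
  push_cast
  rw [show (2 : ℕ) = 1 + 1 from rfl, ← neg_eq_iff_eq_neg, ← neg_one_mul]
  exact h.symm

lemma momentTerm_field_four {L : ℕ} {ρ : Fock L →L[ℂ] Fock L} (α : Fin L → ℂ) {n : Occ L}
    {v : Occ L →₀ ℂ} (hv : toFock L v = opSqrt ρ (numberVec n)) :
    momentTerm ρ (field α ^ 4) n = ((‖toFock L ((fieldFin α ^ 2) v)‖ ^ 2 : ℝ) : ℂ) := by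
  rw [momentTerm_field_pow α 4 hv]
  have h := fieldFin_pow_skew α 2 2 v v
  rw [inner_self_eq_norm_sq_to_K] at h
  push_cast
  simpa using h.symm

/-- Anti-hermiticity gives `‖b v‖² = |⟨v, b² v⟩|`, to which Cauchy-Schwarz applies. -/
lemma norm_sq_fieldFin_le {L : ℕ} (α : Fin L → ℂ) (v : Occ L →₀ ℂ) :
    ‖toFock L (fieldFin α v)‖ ^ 2 ≤ ‖toFock L v‖ * ‖toFock L ((fieldFin α ^ 2) v)‖ := by
  have h := fieldFin_pow_skew α 1 1 v v
  rw [pow_one, inner_self_eq_norm_sq_to_K] at h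
  have h' := congrArg norm h
  rw [norm_mul] at h'
  simp only [norm_pow, norm_neg, norm_one, one_pow, one_mul, RCLike.norm_ofReal,
    abs_norm] at h'
  rw [h']
  exact norm_inner_le_norm _ _

/-- The data of the moments of a number-conserving state with finite fourth moment. -/
lemma IsDensityOperator.moments {L : ℕ} {ρ : Fock L →L[ℂ] Fock L}
    (hρ : IsDensityOperator ρ) (hN : CommutesWithNumber ρ) (α : Fin L → ℂ)
    (hf : FourthMomentFinite ρ α) :
    ∃ s f : ℝ, 0 ≤ s ∧ s ^ 2 ≤ f ∧ secondMoment ρ α α = -(s : ℂ) ∧ fourthMoment ρ α = f ∧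
      ‖expect ρ (weyl α) - (1 - s / 2)‖ ≤ f / 24 := by
  choose v hvp hv using exists_toFock_eq_opSqrt hN
  have h0 : HasSum (fun n => ‖toFock L (v n)‖ ^ 2) 1 := by
    simpa only [hv] using hρ.hasSum_norm_opSqrt
  have h4 : Summable fun n => ‖toFock L ((fieldFin α ^ 2) (v n))‖ ^ 2 := by
    have : Summable fun n => momentTerm ρ (field α ^ 4) n := hf
    simp only [fun n => momentTerm_field_four α (hv n)] at this
    exact_mod_cast this
  -- A weighted arithmetic-geometric mean inequality replacing Cauchy-Schwarz for series: `x = 1`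
  -- gives summability of the second moment, and `x = s` sums to `2s² ≤ s² + f`, that is, `s² ≤ f`.
  have hle : ∀ (x : ℝ) (n : Occ L), 2 * x * ‖toFock L (fieldFin α (v n))‖ ^ 2
      ≤ x ^ 2 * ‖toFock L (v n)‖ ^ 2 + ‖toFock L ((fieldFin α ^ 2) (v n))‖ ^ 2 := by
    intro x n
    have h1 := norm_sq_fieldFin_le α (v n)
    have h2 := sq_nonneg (x * ‖toFock L (v n)‖ - ‖toFock L ((fieldFin α ^ 2) (v n))‖)
    rcases le_total 0 x with hx | hx
    · nlinarith [mul_le_mul_of_nonneg_left h1 hx]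
    · have := mul_nonneg_of_nonpos_of_nonpos hx (neg_nonpos.2
        (sq_nonneg ‖toFock L (fieldFin α (v n))‖))
      nlinarith [sq_nonneg (x * ‖toFock L (v n)‖),
        sq_nonneg ‖toFock L ((fieldFin α ^ 2) (v n))‖]
  have h2 : Summable fun n => ‖toFock L (fieldFin α (v n))‖ ^ 2 := by
    refine Summable.of_nonneg_of_le (fun n => by positivity) (fun n => ?_) (h0.summable.add h4)
    have := hle 1 n
    have := sq_nonneg ‖toFock L (fieldFin α (v n))‖
    linarith
  set s := ∑' n, ‖toFock L (fieldFin α (v n))‖ ^ 2 with hs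
  set f := ∑' n, ‖toFock L ((fieldFin α ^ 2) (v n))‖ ^ 2 with hf'
  have hσ : HasSum (fun n => momentTerm ρ (field α ^ 2) n) (-(s : ℂ)) := by
    simp only [fun n => momentTerm_field_sq α (hv n)]
    exact (Complex.hasSum_ofReal.2 h2.hasSum).neg
  have hφ : HasSum (fun n => momentTerm ρ (field α ^ 4) n) (f : ℂ) := by
    simp only [fun n => momentTerm_field_four α (hv n)]
    exact Complex.hasSum_ofReal.2 h4.hasSum
  refine ⟨s, f, tsum_nonneg fun n => by positivity, ?_, ?_, hφ.tsum_eq, ?_⟩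
  · have := hasSum_le (hle s) (h2.hasSum.mul_left (2 * s)) ((h0.mul_left (s ^ 2)).add h4.hasSum)
    rw [← hs, ← hf'] at this
    nlinarith
  · rw [secondMoment, ← sq]
    exact hσ.tsum_eq
  · have hD : Summable fun n : Occ L =>
        (inner ℂ (toFock L (v n)) (weyl α (toFock L (v n))) : ℂ) := by
      refine Summable.of_norm_bounded h0.summable fun n => ?_
      refine (norm_inner_le_norm _ _).trans_eq ?_
      rw [norm_weyl_apply, sq]
    have h0' : HasSum (fun n => (inner ℂ (toFock L (v n)) (toFock L (v n)) : ℂ)) 1 := by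
      have e : ∀ n, (inner ℂ (toFock L (v n)) (toFock L (v n)) : ℂ)
          = ((‖toFock L (v n)‖ ^ 2 : ℝ) : ℂ) := fun n => by
        rw [inner_self_eq_norm_sq_to_K]; simp
      simp only [e]
      rw [← Complex.ofReal_one]
      exact Complex.hasSum_ofReal.2 h0
    have hE := ((hD.hasSum.sub h0').sub (hσ.div_const 2))
    have hX : expect ρ (weyl α)
        = ∑' n, (inner ℂ (toFock L (v n)) (weyl α (toFock L (v n))) : ℂ) := by
      rw [hρ.expect_eq]
      simp only [hv]
    rw [← hX] at hE
    have := tsum_of_norm_bounded (h4.hasSum.div_const 24) (f := fun n =>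
      (inner ℂ (toFock L (v n)) (weyl α (toFock L (v n))) : ℂ)
        - inner ℂ (toFock L (v n)) (toFock L (v n)) - momentTerm ρ (field α ^ 2) n / 2)
      fun n => by
        rw [momentTerm_field_pow α 2 (hv n)]
        exact norm_inner_weyl_sub_le α (hvp n)
    rw [hE.tsum_eq] at this
    have e : expect ρ (weyl α) - (1 - s / 2) = expect ρ (weyl α) - 1 - -(s : ℂ) / 2 := by ring
    rwa [e]

/-- Each diagonal term is at most `‖√ρ |n⟩‖²` by isometry, and these sum to the trace of `ρ`. -/
lemma IsDensityOperator.norm_expect_weyl_le {L : ℕ} {ρ : Fock L →L[ℂ] Fock L}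
    (hρ : IsDensityOperator ρ) (α : Fin L → ℂ) : ‖expect ρ (weyl α)‖ ≤ 1 := by
  rw [hρ.expect_eq]
  refine tsum_of_norm_bounded hρ.hasSum_norm_opSqrt fun n => ?_
  refine (norm_inner_le_norm _ _).trans_eq ?_
  rw [norm_weyl_apply, sq]

/-- The Gaussian approximation for a single block. -/
lemma IsDensityOperator.norm_expect_weyl_sub_exp_le {L : ℕ} {ρ : Fock L →L[ℂ] Fock L}
    (hρ : IsDensityOperator ρ) (hN : CommutesWithNumber ρ) (α : Fin L → ℂ)
    (hf : FourthMomentFinite ρ α) :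
    ‖Complex.exp (secondMoment ρ α α / 2)‖ ≤ 1 ∧
      ‖expect ρ (weyl α) - Complex.exp (secondMoment ρ α α / 2)‖
        ≤ 7 / 24 * ‖fourthMoment ρ α‖ := by
  obtain ⟨s, f, hs, hsf, h2, h4, h⟩ := hρ.moments hN α hf
  have hf0 : 0 ≤ f := (sq_nonneg s).trans hsf
  have hexp : Complex.exp (secondMoment ρ α α / 2) = ((Real.exp (-(s / 2)) : ℝ) : ℂ) := by
    rw [h2]; push_cast; congr 1; ring
  rw [hexp, h4, Complex.norm_real, Complex.norm_real, Real.norm_of_nonneg hf0,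
    Real.norm_of_nonneg (Real.exp_pos _).le]
  refine ⟨Real.exp_le_one_iff.2 (by linarith), ?_⟩
  have hq := norm_exp_neg_sub_one_add_le (x := s / 2) (by linarith)
  have e : expect ρ (weyl α) - ((Real.exp (-(s / 2)) : ℝ) : ℂ)
      = (expect ρ (weyl α) - (1 - s / 2))
        - ((Real.exp (-(s / 2)) - (1 - s / 2) : ℝ) : ℂ) := by
    push_cast; ring
  rw [e]
  refine (norm_sub_le _ _).trans ?_
  rw [Complex.norm_real, Real.norm_eq_abs]
  -- The two errors are `f/24` and `(s/2)²/2 = s²/8 ≤ f/8`; their sum `f/6` is below `7f/24`.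
  nlinarith

end BosonChain

/-! ### Telescoping over the blocks -/

theorem mainTheorem1 {L : ℕ} (ρ : BosonChain.Fock L →L[ℂ] BosonChain.Fock L)
    (hρ : BosonChain.IsDensityOperator ρ) (hN : BosonChain.CommutesWithNumber ρ)
    (α : Fin L → ℂ) {n : ℕ} (A : Fin n → Set (Fin L))
    (hA : Pairwise (fun i j => Disjoint (A i) (A j)))
    (hσ : ∀ i, ‖BosonChain.secondMoment ρ ((A i).indicator α) ((A i).indicator α)‖ ≤ 1)
    (hf : ∀ i, BosonChain.FourthMomentFinite ρ ((A i).indicator α)) :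
    ‖(∏ i, BosonChain.expect ρ (BosonChain.weyl ((A i).indicator α)))
        - Complex.exp (∑ i, BosonChain.secondMoment ρ ((A i).indicator α) ((A i).indicator α) / 2)‖
      ≤ 7 / 24 * ∑ i, ‖BosonChain.fourthMoment ρ ((A i).indicator α)‖ := by
  have h := fun i => hρ.norm_expect_weyl_sub_exp_le hN _ (hf i)
  rw [Complex.exp_sum, Finset.mul_sum]
  exact (BosonChain.norm_prod_sub_prod_le_sum _ _ _ (fun i _ => hρ.norm_expect_weyl_le _)
    fun i _ => (h i).1).trans (Finset.sum_le_sum fun i _ => (h i).2)
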